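/- Let $\mathrm{PRIMES}=\{u\in\{0,1\}^* : \sum_{i<|u|}u(i)2^i \text{ is prime}\}$ be the set of prime numbers written in binary, least significant digit first (leading zeros of the number being allowed). An alternating Turing machine has a finite set of control states, each of which is existential, universal, accepting or rejecting (the last two being halting), a finite work alphabet, a read-only input tape that holds the input word between two endmarkers, which the input head does not leave, and a fixed finite number of two-way infinite work tapes, which are blank at the start. The input head starts on the left endmarker. An input is accepted if Prover wins the game in which, from the initial configuration on, Prover chooses the next step in existential states and Verifier in universal states: Prover wins a play if it reaches an accepting state after finitely many steps, or a universal configuration without successor. The machine is \emph{one-way} if on every computation path its input head never moves to the left, and \emph{realtime} if there is a bound $K$ such that on every computation path on every input the input head stays at the same place for at most $K$ consecutive steps. It \emph{uses space} $f:\mathbb{N}\to\mathbb{N}$ if on every input of length $n$ every computation path visits at most $f(n)$ work-tape cells (in total over all work tapes). Then for every $f:\mathbb{N}\to\mathbb{N}$ with $f(n)=o(\log n)$, no one-way realtime alternating Turing machine that uses space $f$ recognises $\mathrm{PRIMES}$, that is, accepts exactly the words of $\mathrm{PRIMES}$. -/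

import Mathlib

/-- The content of a cell of the read-only input tape: a left endmarker, a letter of the input
alphabet, or a right endmarker. -/
inductive InputSymbol (α : Type*) where
  | leftEnd : InputSymbol α
  | letter (a : α) : InputSymbol α
  | rightEnd : InputSymbol α

/-- The moves of a tape head. -/
inductive HeadMove where
  | left
  | stay
  | right

/-- The modes of the control states of an alternating machine: existential (disjunctive choice of
Prover), universal (conjunctive choice of Verifier), or halting with a verdict. -/
inductive StateMode where
  | existential
  | universal
  | accept
  | reject

/-- The instruction carried out in one step: the new control state, the symbols written on the work
tapes, the move of the input head, and the moves of the work heads. -/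
structure TMAction (Q Γ : Type*) (k : ℕ) where
  state : Q
  write : Fin k → Γ
  moveInput : HeadMove
  moveWork : Fin k → HeadMove

/-- An alternating Turing machine with input alphabet `α`, set of control states `Q`, work alphabet
`Γ`, a two-way read-only input tape and `k` two-way infinite work tapes. The set `trans q a g` holds
the actions available in the state `q` when the input head scans `a` and the work heads scan `g`. -/
structure AlternatingTM (α Q Γ : Type*) (k : ℕ) where
  start : Q
  blank : Γ
  mode : Q → StateMode
  trans : Q → InputSymbol α → (Fin k → Γ) → Set (TMAction Q Γ k)

/-- A configuration: the control state, the position of the input head, the contents of the work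
tapes, and the positions of the work heads. -/
structure TMConfig (Q Γ : Type*) (k : ℕ) where
  state : Q
  inputPos : ℕ
  tape : Fin k → ℤ → Γ
  head : Fin k → ℤ

/-- The input tape for the word `w` of length `n`: the left endmarker in cell `0`, the letters of
`w` in the cells `1, …, n`, and the right endmarker in cell `n + 1`. -/
def inputTape {α : Type*} (w : List α) : ℕ → InputSymbol α
  | 0 => .leftEnd
  | i + 1 => match w[i]? with
    | some a => .letter a
    | none => .rightEnd

/-- The new position of the head of an input tape whose cells are `0, …, n + 1`; a move that would
leave the tape has no effect. -/
def HeadMove.onInput (n : ℕ) : HeadMove → ℕ → ℕ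
  | .left, i => i - 1
  | .stay, i => i
  | .right, i => min (i + 1) (n + 1)

/-- The new position of the head of a work tape. -/
def HeadMove.onWork : HeadMove → ℤ → ℤ
  | .left, z => z - 1
  | .stay, z => z
  | .right, z => z + 1

namespace AlternatingTM

variable {α Q Γ : Type*} {k : ℕ}

/-- The initial configuration: all work tapes are blank, and the input head is on the left
endmarker. -/
def init (M : AlternatingTM α Q Γ k) : TMConfig Q Γ k where
  state := M.start
  inputPos := 0
  tape := fun _ _ => M.blank
  head := fun _ => 0

/-- The configuration that the action `t` leads to from `c`, on inputs of length `n`. -/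
def apply (n : ℕ) (t : TMAction Q Γ k) (c : TMConfig Q Γ k) : TMConfig Q Γ k where
  state := t.state
  inputPos := t.moveInput.onInput n c.inputPos
  tape := fun i => Function.update (c.tape i) (c.head i) (t.write i)
  head := fun i => (t.moveWork i).onWork (c.head i)

/-- `M.Step w c d`: on the input `w`, the configuration `d` is a successor of `c`. Configurations in
an accepting or rejecting state are halting. -/
def Step (M : AlternatingTM α Q Γ k) (w : List α) (c d : TMConfig Q Γ k) : Prop :=
  (M.mode c.state = .existential ∨ M.mode c.state = .universal) ∧
    ∃ t ∈ M.trans c.state (inputTape w c.inputPos) (fun i => c.tape i (c.head i)),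
      d = apply w.length t c

/-- `M.Wins w c`: on the input `w`, Prover wins the game that starts from the configuration `c`,
where Prover chooses the successor of existential configurations, Verifier that of universal ones,
and Prover has to reach an accepting halting configuration (or one in which Verifier has to choose
and cannot) after finitely many steps. -/
inductive Wins (M : AlternatingTM α Q Γ k) (w : List α) : TMConfig Q Γ k → Prop
  | accept (c : TMConfig Q Γ k) (hc : M.mode c.state = .accept) : Wins M w c
  | existential (c d : TMConfig Q Γ k) (hc : M.mode c.state = .existential)
      (hcd : M.Step w c d) (hd : Wins M w d) : Wins M w c
  | universal (c : TMConfig Q Γ k) (hc : M.mode c.state = .universal)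
      (h : ∀ d, M.Step w c d → Wins M w d) : Wins M w c

/-- The language recognised by the machine. -/
def language (M : AlternatingTM α Q Γ k) : Language α :=
  {w | M.Wins w M.init}

/-- `M.IsComputation w p`: the list `p` of configurations is a finite (not necessarily complete)
computation path of `M` on the input `w`, starting from the initial configuration. -/
def IsComputation (M : AlternatingTM α Q Γ k) (w : List α) (p : List (TMConfig Q Γ k)) : Prop :=
  p.head? = some M.init ∧ p.IsChain (M.Step w)

/-- The input head never moves to the left. -/
def IsOneWay (M : AlternatingTM α Q Γ k) : Prop :=
  ∀ w p, M.IsComputation w p → p.IsChain (fun c d => c.inputPos ≤ d.inputPos)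

/-- There is a bound `K` such that the input head stays at the same place for at most `K` steps, that
is, for at most `K + 1` consecutive configurations of a computation. -/
def IsRealtime (M : AlternatingTM α Q Γ k) : Prop :=
  ∃ K : ℕ, ∀ w p, M.IsComputation w p → ∀ s, s <:+: p →
    (∀ c ∈ s, ∀ d ∈ s, c.inputPos = d.inputPos) → s.length ≤ K + 1

/-- The set of work-tape cells visited along `p`; the pair `(i, z)` is the cell `z` of the `i`-th
work tape. -/
def visited (p : List (TMConfig Q Γ k)) : Set (Fin k × ℤ) :=
  {x | ∃ c ∈ p, c.head x.1 = x.2}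

/-- The machine uses space `f`: on every input of length `n`, every computation path visits at most
`f n` work-tape cells. -/
def UsesSpace (M : AlternatingTM α Q Γ k) (f : ℕ → ℕ) : Prop :=
  ∀ w p, M.IsComputation w p → (visited p).encard ≤ f w.length

end AlternatingTM

/-- The number written in binary by `w`, with the least significant digit first. -/
def binValue (w : List Bool) : ℕ :=
  ∑ i : Fin w.length, (w.get i).toNat * 2 ^ (i : ℕ)

/-- The language of the prime numbers written in binary. -/
def binaryPrimes : Language Bool :=
  {w | (binValue w).Prime}

/-! This is a counting argument. Once the head of a one-way machine has left a prefix `u` of length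
`n`, the rest of the game depends only on the current configuration and the suffix `v`. So `v`
affects the acceptance of such prefixes only through the set of crossing configurations from which
Prover wins (`mem_language_of_winning_eq`). Each odd `x < 2 ^ n` has a suffix for which `x` alone
gives a prime (`exists_prime_add_two_pow_mul_unique`). These `2 ^ (n - 1)` suffixes need distinct
winning sets, so there are at least `n - 1` crossing configurations. A crossing configuration
already occurs on the input `u` itself, so its space is bounded by `f n` however long `v` is, and
only `n ^ o(1)` of them exist (`UsesSpace.crossing_bound`). -/

/-! ### Primes with a prescribed pattern of low order digits -/

/-- The Chinese remainder theorem gives `z ≡ x` mod `2 ^ n` and `z ≡ x - i` mod `q i` for `i ≠ x`,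
with distinct primes `q i > 2 ^ n`. Dirichlet's theorem gives a large prime `p ≡ z`; then `q i`
properly divides `p - x + i`. -/
theorem exists_prime_add_two_pow_mul_unique (n x : ℕ) (hx : x < 2 ^ n) (hodd : Odd x) :
    ∃ y, (x + 2 ^ n * y).Prime ∧ ∀ x' < 2 ^ n, x' ≠ x → ¬ (x' + 2 ^ n * y).Prime := by
  let q : ℕ → ℕ := fun i => Nat.nth Nat.Prime (2 ^ n + i)
  have hqp : ∀ i, (q i).Prime := fun i => Nat.prime_nth_prime _
  have hqgt : ∀ i, 2 ^ n < q i := fun i => by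
    have := Nat.add_two_le_nth_prime (2 ^ n + i)
    simp only [q]; omega
  have hqinj : ∀ i j, i ≠ j → q i ≠ q j := fun i j hij h => by
    have := Nat.nth_injective Nat.infinite_setOfPred_prime h
    omega
  have hpos : 0 < 2 ^ n := by positivity
  have hq2 : ∀ i, Nat.Coprime (2 ^ n) (q i) := fun i => by
    refine Nat.Coprime.pow_left _ ((Nat.coprime_primes Nat.prime_two (hqp i)).2 fun h => ?_)
    have h1 := hqgt i
    rw [← h] at h1
    have : n ≠ 0 := by
      rintro rfl
      obtain ⟨r, hr⟩ := hodd
      simp at hx; omega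
    have : 2 ^ 1 ≤ 2 ^ n := Nat.pow_le_pow_right (by norm_num) (by omega)
    omega
  let s : ℕ → ℕ := fun i => if i = x then 2 ^ n else q i
  -- Modulo `q i` this is `x - i`, without truncated subtraction.
  let a : ℕ → ℕ := fun i => if i = x then x else x + (q i - 1) * i
  have hs : ∀ i ∈ Finset.range (2 ^ n), s i ≠ 0 := fun i _ => by
    simp only [s]; split_ifs
    · exact hpos.ne'
    · exact (hqp i).ne_zero
  have hcop : Set.Pairwise (↑(Finset.range (2 ^ n))) (Function.onFun Nat.Coprime s) := by
    intro i _ j _ hij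
    simp only [Function.onFun, s]
    split_ifs with h1 h2 h2
    · exact absurd (h1.trans h2.symm) hij
    · exact hq2 j
    · exact (hq2 i).symm
    · exact (Nat.coprime_primes (hqp i) (hqp j)).2 (hqinj i j hij)
  obtain ⟨z, hz⟩ := Nat.chineseRemainderOfFinset a s (Finset.range (2 ^ n)) hs hcop
  have hzx : z ≡ x [MOD 2 ^ n] := by
    simpa [s, a] using hz x (Finset.mem_range.2 hx)
  have hzq : ∀ i < 2 ^ n, i ≠ x → z + i ≡ x [MOD q i] := by
    intro i hi hix
    have h := (hz i (Finset.mem_range.2 hi)).add_right i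
    simp only [s, a, if_neg hix] at h
    refine h.trans ?_
    have h1 : x + (q i - 1) * i + i = x + q i * i := by
      obtain ⟨m, hm⟩ := Nat.exists_eq_add_of_lt (hqp i).pos
      rw [hm]; simp; ring
    rw [h1]
    simp [Nat.ModEq]
  set P := ∏ i ∈ Finset.range (2 ^ n), s i with hP
  have hP0 : P ≠ 0 := Finset.prod_ne_zero_iff.2 hs
  have hzP : Nat.Coprime z P := by
    refine Nat.Coprime.prod_right fun i hi => ?_
    simp only [s]
    split_ifs with h
    · refine Nat.Coprime.pow_right _ ?_
      rw [Nat.coprime_two_right]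
      rcases Nat.even_or_odd z with he | ho
      · exfalso
        have hn : n ≠ 0 := by
          rintro rfl
          obtain ⟨r, hr⟩ := hodd
          simp at hx; omega
        have h2 := hzx.of_dvd (dvd_pow_self 2 hn)
        obtain ⟨r, hr⟩ := hodd
        obtain ⟨t, ht⟩ := he
        simp only [Nat.ModEq] at h2
        omega
      · exact ho
    · refine Nat.Coprime.symm ((Nat.Prime.coprime_iff_not_dvd (hqp i)).2 fun hd => h ?_)
      have h1 := hzq i (Finset.mem_range.1 hi) h
      have h2 : i ≡ x [MOD q i] := by
        refine Nat.ModEq.trans ?_ h1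
        obtain ⟨r, hr⟩ := hd
        rw [hr]
        simp [Nat.ModEq]
      exact h2.eq_of_lt_of_lt ((Finset.mem_range.1 hi).trans (hqgt i)) (hx.trans (hqgt i))
  -- The sum makes `p` so large that no `i + 2 ^ n * y` equals its divisor `q i`.
  obtain ⟨p, hpgt, hpp, hpz⟩ := Nat.forall_exists_prime_gt_and_modEq
    (2 ^ n + ∑ i ∈ Finset.range (2 ^ n), q i) hP0 hzP
  have hdvd : ∀ i < 2 ^ n, s i ∣ P := fun i hi => Finset.dvd_prod_of_mem s (Finset.mem_range.2 hi)
  have hpx : x ≡ p [MOD 2 ^ n] := by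
    have h1 := hdvd x hx
    simp only [s, if_true] at h1
    exact ((hpz.of_dvd h1).trans hzx).symm
  obtain ⟨y, hy⟩ := (Nat.modEq_iff_dvd' (by omega)).1 hpx
  have hpy : x + 2 ^ n * y = p := by omega
  refine ⟨y, hpy ▸ hpp, fun i hi hix hprime => ?_⟩
  have h1 := hdvd i hi
  simp only [s, if_neg hix] at h1
  have h2 : p + i ≡ x [MOD q i] := ((hpz.of_dvd h1).add_right i).trans (hzq i hi hix)
  have h3 : q i ∣ i + 2 ^ n * y := by
    have := (Nat.modEq_iff_dvd' (by omega)).1 h2.symm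
    rwa [show p + i - x = i + 2 ^ n * y by omega] at this
  have h4 := (Nat.prime_dvd_prime_iff_eq (hqp i) hprime).1 h3
  have h5 : q i ≤ ∑ i ∈ Finset.range (2 ^ n), q i :=
    Finset.single_le_sum (f := q) (fun _ _ => Nat.zero_le _) (Finset.mem_range.2 hi)
  omega

/-! ### Binary notation -/

theorem binValue_cons (b : Bool) (w : List Bool) :
    binValue (b :: w) = b.toNat + 2 * binValue w := by
  simp only [binValue, List.length_cons]
  rw [Fin.sum_univ_succ, Finset.mul_sum]
  simp only [List.get_eq_getElem, Fin.val_zero, List.getElem_cons_zero, pow_zero, mul_one,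
    Fin.val_succ, List.getElem_cons_succ, add_right_inj]
  exact Finset.sum_congr rfl fun i _ => by ring

theorem binValue_append (u v : List Bool) :
    binValue (u ++ v) = binValue u + 2 ^ u.length * binValue v := by
  induction u with
  | nil => simp [binValue]
  | cons b u ih =>
    rw [List.cons_append, binValue_cons, binValue_cons, ih, List.length_cons]
    ring

theorem exists_binValue_eq (n x : ℕ) (hx : x < 2 ^ n) :
    ∃ u : List Bool, u.length = n ∧ binValue u = x := by
  induction n generalizing x with
  | zero => exact ⟨[], rfl, by simp at hx; simp [binValue, hx]⟩
  | succ n ih =>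
    obtain ⟨u, hu, hux⟩ := ih (x / 2) (by rw [pow_succ] at hx; omega)
    refine ⟨decide (x % 2 = 1) :: u, by simp [hu], ?_⟩
    rw [binValue_cons, hux]
    rcases Nat.mod_two_eq_zero_or_one x with h | h <;> simp [h] <;> omega

/-! ### The input tape -/

theorem inputTape_append_of_le {α : Type*} (u v : List α) {i : ℕ} (hi : i ≤ u.length) :
    inputTape (u ++ v) i = inputTape u i := by
  cases i with
  | zero => rfl
  | succ i =>
    simp only [inputTape]
    rw [List.getElem?_append_left (by omega)]

theorem inputTape_append_of_lt {α : Type*} {u u' : List α} (v : List α)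
    (h : u.length = u'.length) {i : ℕ} (hi : u.length < i) :
    inputTape (u ++ v) i = inputTape (u' ++ v) i := by
  cases i with
  | zero => omega
  | succ i =>
    simp only [inputTape]
    rw [List.getElem?_append_right (by omega), List.getElem?_append_right (by omega), h]

namespace AlternatingTM

variable {α Q Γ : Type*} {k : ℕ} {M : AlternatingTM α Q Γ k}

/-- A step from within `u` ends at most one cell beyond it, where the right endmarker of `u` stands,
so clamping never shows the difference. -/
theorem step_append_iff (u v : List α) {c : TMConfig Q Γ k} (hc : c.inputPos ≤ u.length)
    (d : TMConfig Q Γ k) : M.Step (u ++ v) c d ↔ M.Step u c d := by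
  have h : ∀ t : TMAction Q Γ k, apply (u ++ v).length t c = apply u.length t c := by
    intro t
    simp only [apply, TMConfig.mk.injEq, true_and, and_true]
    cases t.moveInput <;> simp only [HeadMove.onInput, List.length_append]
    omega
  simp only [Step, h, inputTape_append_of_le u v hc]

theorem step_append_congr {u u' : List α} (v : List α) (h : u.length = u'.length)
    {c : TMConfig Q Γ k} (hc : u.length < c.inputPos) (d : TMConfig Q Γ k) :
    M.Step (u ++ v) c d ↔ M.Step (u' ++ v) c d := by
  simp only [Step, inputTape_append_of_lt v h hc, List.length_append, h]

theorem Step.inputPos_le {w : List α} {c d : TMConfig Q Γ k} (h : M.Step w c d) :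
    d.inputPos ≤ c.inputPos + 1 := by
  obtain ⟨-, t, -, rfl⟩ := h
  simp only [apply]
  cases t.moveInput <;> simp only [HeadMove.onInput] <;> omega

/-- Winning depends only on the steps available from the configurations that can be reached. -/
theorem Wins.congr {w w' : List α} {c : TMConfig Q Γ k} (hw : M.Wins w c)
    (h : ∀ e, Relation.ReflTransGen (M.Step w) c e → ∀ d, M.Step w e d ↔ M.Step w' e d) :
    M.Wins w' c := by
  induction hw with
  | accept c hc => exact .accept c hc
  | existential c d hc hcd _ ih =>
    exact .existential c d hc ((h c .refl d).1 hcd) (ih fun e he => h e (.head hcd he))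
  | universal c hc _ ih =>
    refine .universal c hc fun d hd => ?_
    have hd' := (h c .refl d).2 hd
    exact ih d hd' fun e he => h e (.head hd' he)

/-- Every reachable configuration is the end of a computation path; the cells visited on it contain
the scanned ones and the non-blank ones, and they form an interval around the origin. -/
theorem exists_isComputation {w : List α} {c : TMConfig Q Γ k}
    (h : Relation.ReflTransGen (M.Step w) M.init c) :
    ∃ p, M.IsComputation w p ∧ p.getLast? = some c ∧ (∀ i, (i, c.head i) ∈ visited p) ∧
      (∀ i z, c.tape i z ≠ M.blank → (i, z) ∈ visited p) ∧
      ∀ i z, (i, z) ∈ visited p → ∀ y ∈ Set.uIcc 0 z, (i, y) ∈ visited p := by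
  induction h with
  | refl =>
    refine ⟨[M.init], ⟨rfl, List.isChain_singleton _⟩, rfl, fun i => ⟨M.init, by simp, rfl⟩,
      fun i z hz => absurd rfl hz, ?_⟩
    rintro i z ⟨c, hc, hz⟩ y hy
    rw [List.mem_singleton] at hc
    subst hc
    have hz0 : z = 0 := hz.symm
    subst hz0
    refine ⟨M.init, by simp, ?_⟩
    simpa [init, eq_comm] using hy
  | @tail c d _ hcd ih =>
    obtain ⟨p, ⟨hp1, hp2⟩, hlast, hhead, htape, hint⟩ := ih
    have hsub : visited p ⊆ visited (p ++ [d]) := by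
      rintro x ⟨e, he, hx⟩
      exact ⟨e, by simp [he], hx⟩
    have hd : ∀ i, (i, d.head i) ∈ visited (p ++ [d]) := fun i => ⟨d, by simp, rfl⟩
    refine ⟨p ++ [d], ⟨?_, ?_⟩, by simp, hd, ?_, ?_⟩
    · rw [List.head?_append, hp1]; rfl
    · refine hp2.append (List.isChain_singleton _) fun x hx y hy => ?_
      rw [hlast] at hx
      simp only [Option.mem_def, Option.some.injEq, List.head?_cons] at hx hy
      subst hx; subst hy
      exact hcd
    · intro i z hz
      obtain ⟨-, t, -, rfl⟩ := hcd
      by_cases hzi : z = c.head i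
      · exact hsub (hzi ▸ hhead i)
      · refine hsub (htape i z ?_)
        simpa [apply, Function.update_of_ne hzi] using hz
    · rintro i z ⟨e, he, hz⟩ y hy
      rw [List.mem_append, List.mem_singleton] at he
      rcases he with he | rfl
      · exact hsub (hint i z ⟨e, he, hz⟩ y hy)
      · change e.head i = z at hz
        by_cases hyz : y = z
        · exact hyz ▸ hz ▸ hd i
        · refine hsub (hint i _ (hhead i) y ?_)
          have hmove : z = c.head i - 1 ∨ z = c.head i ∨ z = c.head i + 1 := by
            obtain ⟨-, t, -, rfl⟩ := hcd
            rw [← hz]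
            simp only [apply]
            cases t.moveWork i <;> simp [HeadMove.onWork]
          rw [Set.mem_uIcc] at hy ⊢
          omega

theorem IsOneWay.inputPos_le_of_step (hone : M.IsOneWay) {w : List α} {c d : TMConfig Q Γ k}
    (hc : Relation.ReflTransGen (M.Step w) M.init c) (hcd : M.Step w c d) :
    c.inputPos ≤ d.inputPos := by
  obtain ⟨p, ⟨hp1, hp2⟩, hlast, -⟩ := exists_isComputation hc
  have hp : M.IsComputation w (p ++ [d]) := by
    refine ⟨by rw [List.head?_append, hp1]; rfl, ?_⟩
    refine hp2.append (List.isChain_singleton _) fun x hx y hy => ?_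
    rw [hlast] at hx
    simp only [Option.mem_def, Option.some.injEq, List.head?_cons] at hx hy
    subst hx; subst hy
    exact hcd
  exact (List.isChain_append.1 (hone w _ hp)).2.2 c hlast d rfl

theorem IsOneWay.inputPos_le (hone : M.IsOneWay) {w : List α} {c d : TMConfig Q Γ k}
    (hc : Relation.ReflTransGen (M.Step w) M.init c)
    (hcd : Relation.ReflTransGen (M.Step w) c d) : c.inputPos ≤ d.inputPos := by
  induction hcd with
  | refl => exact le_rfl
  | tail h1 h2 ih => exact ih.trans (hone.inputPos_le_of_step (hc.trans h1) h2)

/-- Reaching cell `z` means visiting all cells between `0` and `z`. -/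
theorem UsesSpace.natAbs_le {f : ℕ → ℕ} (hspace : M.UsesSpace f) {w : List α}
    {c : TMConfig Q Γ k} (hc : Relation.ReflTransGen (M.Step w) M.init c) (i : Fin k) :
    c.head i ∈ Finset.Icc (-(f w.length : ℤ)) (f w.length) ∧
      ∀ z, c.tape i z ≠ M.blank → z ∈ Finset.Icc (-(f w.length : ℤ)) (f w.length) := by
  obtain ⟨p, hp, -, hhead, htape, hint⟩ := exists_isComputation hc
  have key : ∀ z, (i, z) ∈ visited p → z ∈ Finset.Icc (-(f w.length : ℤ)) (f w.length) := by
    intro z hz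
    have h1 : ((fun y : ℤ => (i, y)) '' Set.uIcc 0 z).encard ≤ f w.length := by
      refine le_trans (Set.encard_le_encard ?_) (hspace w p hp)
      rintro _ ⟨y, hy, rfl⟩
      exact hint i z hz y hy
    rw [Function.Injective.encard_image (fun a b h => (Prod.mk.inj h).2),
      ← Finset.coe_uIcc, Set.encard_coe_eq_coe_finsetCard, Int.card_uIcc] at h1
    have h2 : (z - 0).natAbs + 1 ≤ f w.length := by exact_mod_cast h1
    rw [Finset.mem_Icc]
    omega
  exact ⟨key _ (hhead i), fun z hz => key z (htape i z hz)⟩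

/-! ### Configurations in which the input head leaves the first part of the input -/

/-- The configuration `c` can occur when the input head has just left the word `u`. -/
def Crosses (M : AlternatingTM α Q Γ k) (u : List α) (d : TMConfig Q Γ k) : Prop :=
  Relation.ReflTransGen (M.Step u) M.init d ∧ d.inputPos = u.length + 1 ∧
    ∀ v, Relation.ReflTransGen (M.Step (u ++ v)) M.init d

/-- The configurations that can occur when the input head has just left a word of length `n`. -/
def crossing (M : AlternatingTM α Q Γ k) (n : ℕ) : Set (TMConfig Q Γ k) :=
  {d | ∃ u : List α, u.length = n ∧ M.Crosses u d}

/-- The configurations at the end of words of length `n` from which Prover wins if `v` follows. -/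
def winning (M : AlternatingTM α Q Γ k) (n : ℕ) (v : List α) : Set (TMConfig Q Γ k) :=
  {d | ∃ u : List α, u.length = n ∧ M.Crosses u d ∧ M.Wins (u ++ v) d}

theorem winning_subset_crossing (n : ℕ) (v : List α) : M.winning n v ⊆ M.crossing n :=
  fun _ ⟨u, hu, hd, _⟩ => ⟨u, hu, hd⟩

/-- The head never returns to the prefix, so which prefix of that length was read is irrelevant. -/
theorem Crosses.mem_winning_iff (hone : M.IsOneWay) {u : List α} {d : TMConfig Q Γ k}
    (hd : M.Crosses u d) (v : List α) : d ∈ M.winning u.length v ↔ M.Wins (u ++ v) d := by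
  refine ⟨?_, fun h => ⟨u, rfl, hd, h⟩⟩
  rintro ⟨u', hu', hd', hw⟩
  refine hw.congr fun e he e' => step_append_congr v hu' ?_ e'
  have := hone.inputPos_le (hd'.2.2 v) he
  rw [hd'.2.1] at this
  omega

/-- Prover keeps the same strategy inside `u`; on crossing, equality of the winning sets lets `v'`
replace `v`. -/
theorem Wins.of_winning_eq (hone : M.IsOneWay) {u v v' : List α}
    (h : M.winning u.length v = M.winning u.length v') {c : TMConfig Q Γ k}
    (hw : M.Wins (u ++ v) c) (hpos : c.inputPos ≤ u.length)
    (hc : ∀ v, Relation.ReflTransGen (M.Step (u ++ v)) M.init c) : M.Wins (u ++ v') c := by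
  have next : ∀ {c d : TMConfig Q Γ k}, c.inputPos ≤ u.length →
      (∀ v, Relation.ReflTransGen (M.Step (u ++ v)) M.init c) → M.Step u c d →
      M.Wins (u ++ v) d →
      (d.inputPos ≤ u.length → (∀ v, Relation.ReflTransGen (M.Step (u ++ v)) M.init d) →
        M.Wins (u ++ v') d) → M.Wins (u ++ v') d := by
    intro c d hpos hc hcd hd ih
    have hreach : ∀ v, Relation.ReflTransGen (M.Step (u ++ v)) M.init d :=
      fun v => (hc v).tail ((step_append_iff u v hpos d).2 hcd)
    by_cases hdpos : d.inputPos ≤ u.length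
    · exact ih hdpos hreach
    · have hcross : M.Crosses u d :=
        ⟨by simpa using hreach [], by have := hcd.inputPos_le; omega, hreach⟩
      rwa [← hcross.mem_winning_iff hone, ← h, hcross.mem_winning_iff hone]
  induction hw with
  | accept c hm => exact .accept c hm
  | existential c d hm hcd hd ih =>
    have hcd' := (step_append_iff u v hpos d).1 hcd
    exact .existential c d hm ((step_append_iff u v' hpos d).2 hcd') (next hpos hc hcd' hd ih)
  | universal c hm hall ih =>
    refine .universal c hm fun d hcd => ?_
    have hcd' := (step_append_iff u v' hpos d).1 hcd
    have hcd'' := (step_append_iff u v hpos d).2 hcd'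
    exact next hpos hc hcd' (hall d hcd'') (ih d hcd'')

theorem mem_language_of_winning_eq (hone : M.IsOneWay) {u v v' : List α}
    (h : M.winning u.length v = M.winning u.length v') (hw : u ++ v ∈ M.language) :
    u ++ v' ∈ M.language :=
  Wins.of_winning_eq hone h hw (Nat.zero_le _) fun _ => .refl

theorem UsesSpace.crossing_bound [Finite Q] [Finite Γ] {f : ℕ → ℕ} (hspace : M.UsesSpace f)
    (n : ℕ) : (M.crossing n).Finite ∧ (M.crossing n).ncard ≤
      Nat.card Q * ((2 * f n + 1) ^ k * (Nat.card Γ ^ (2 * f n + 1)) ^ k) := by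
  let I := Finset.Icc (-(f n : ℤ)) (f n)
  have hmem : ∀ d : M.crossing n, ∀ i, d.1.head i ∈ I ∧
      ∀ z, d.1.tape i z ≠ M.blank → z ∈ I := by
    rintro ⟨d, u, hu, hd⟩ i
    have := hspace.natAbs_le hd.1 i
    rwa [hu] at this
  -- The input position is fixed at `n + 1`, and the tapes are blank outside `I`.
  let g : M.crossing n → Q × (Fin k → I) × (Fin k → I → Γ) := fun d =>
    (d.1.state, fun i => ⟨d.1.head i, (hmem d i).1⟩, fun i z => d.1.tape i z)
  have hg : Function.Injective g := by
    intro c d hcd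
    simp only [g, Prod.mk.injEq] at hcd
    obtain ⟨h1, h2, h3⟩ := hcd
    have hpos : c.1.inputPos = d.1.inputPos := by
      obtain ⟨_, u, hu, hc⟩ := c
      obtain ⟨_, u', hu', hd⟩ := d
      rw [hc.2.1, hd.2.1, hu, hu']
    have hhead : c.1.head = d.1.head := by
      funext i
      exact congrArg Subtype.val (congrFun h2 i)
    have htape : c.1.tape = d.1.tape := by
      funext i z
      by_cases hz : z ∈ I
      · exact congrFun (congrFun h3 i) ⟨z, hz⟩
      · rw [not_not.1 (mt ((hmem c i).2 z) hz), not_not.1 (mt ((hmem d i).2 z) hz)]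
    apply Subtype.ext
    rcases hc : c.1 with ⟨_, _, _, _⟩
    rcases hd : d.1 with ⟨_, _, _, _⟩
    simp_all
  have hfin : Finite (M.crossing n) := Finite.of_injective g hg
  refine ⟨hfin, ?_⟩
  have hI : Nat.card I = 2 * f n + 1 := by
    rw [Nat.card_eq_fintype_card, Fintype.card_coe, Int.card_Icc]
    omega
  calc (M.crossing n).ncard ≤ Nat.card (Q × (Fin k → I) × (Fin k → I → Γ)) :=
        Nat.card_le_card_of_injective g hg
    _ = _ := by
        rw [Nat.card_prod, Nat.card_prod, Nat.card_fun, Nat.card_fun, Nat.card_fun, hI,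
          Nat.card_fin]

end AlternatingTM

/-- A one-way machine for the primes reaches at least `n` configurations after `n + 1` digits. -/
theorem le_ncard_crossing_of_language_eq {Q Γ : Type*} {k : ℕ} {M : AlternatingTM Bool Q Γ k}
    (hone : M.IsOneWay) (hM : M.language = binaryPrimes) (n : ℕ)
    (hfin : (M.crossing (n + 1)).Finite) : n ≤ (M.crossing (n + 1)).ncard := by
  have hlt : ∀ j : Fin (2 ^ n), 2 * (j : ℕ) + 1 < 2 ^ (n + 1) := fun j => by
    have := j.2
    rw [pow_succ]; omega
  choose y hy hy' using fun j : Fin (2 ^ n) =>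
    exists_prime_add_two_pow_mul_unique (n + 1) (2 * j + 1) (hlt j) ⟨j, rfl⟩
  -- Any sufficient length works; `y j` digits are enough for `y j`.
  choose v hv hvy using fun j => exists_binValue_eq (y j) (y j) Nat.lt_two_pow_self
  have hinj : Function.Injective fun j => M.winning (n + 1) (v j) := by
    intro i j hij
    by_contra hne
    obtain ⟨u, hu, hux⟩ := exists_binValue_eq (n + 1) (2 * i + 1) (hlt i)
    have hval : ∀ l, binValue (u ++ v l) = 2 * i + 1 + 2 ^ (n + 1) * y l := fun l => by
      rw [binValue_append, hu, hux, hvy]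
    have h1 : u ++ v i ∈ M.language := by
      rw [hM]
      change (binValue _).Prime
      rw [hval]
      exact hy i
    have h2 : u ++ v j ∈ M.language :=
      AlternatingTM.mem_language_of_winning_eq hone (by rw [hu]; exact hij) h1
    rw [hM] at h2
    change (binValue _).Prime at h2
    rw [hval] at h2
    exact hy' j _ (hlt i) (fun h => hne (Fin.ext (by omega))) h2
  have hcard : 2 ^ n ≤ 2 ^ (M.crossing (n + 1)).ncard := by
    rw [← Set.ncard_powerset _ hfin, ← Nat.card_fin (2 ^ n), ← Nat.card_coe_set_eq]
    have : Finite (𝒫 (M.crossing (n + 1))) := hfin.finite_subsets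
    exact Nat.card_le_card_of_injective
      (fun j => ⟨_, AlternatingTM.winning_subset_crossing (n + 1) (v j)⟩)
      fun i j h => hinj (congrArg Subtype.val h)
  exact (Nat.pow_le_pow_iff_right (by norm_num)).1 hcard

/-- An exponential in a function that is `o(log n)` is eventually smaller than `n - 1`. -/
theorem eventually_pow_lt_of_isLittleO_log {f : ℕ → ℕ}
    (hf : (fun n : ℕ => (f n : ℝ)) =o[Filter.atTop] fun n : ℕ => Real.log (n : ℝ)) (A K : ℕ) :
    ∀ᶠ n : ℕ in Filter.atTop, A * 2 ^ (K * (2 * f n + 1)) + 1 < n := by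
  -- Chosen so that `2 * K * f n ≤ log n / 2`, whence `2 ^ (2 * K * f n) ≤ √n`.
  have hε : (0 : ℝ) < 1 / (4 * K + 4) := by positivity
  have hsqrt : Filter.Tendsto (fun n : ℕ => √(n : ℝ)) Filter.atTop Filter.atTop :=
    Real.tendsto_sqrt_atTop.comp tendsto_natCast_atTop_atTop
  filter_upwards [hf.def hε, Filter.eventually_ge_atTop 1,
    hsqrt.eventually_gt_atTop (A * 2 ^ K + 1 : ℝ)] with n hn hn1 hn2
  have hn1' : (1 : ℝ) ≤ n := by exact_mod_cast hn1
  have hlog : 0 ≤ Real.log n := Real.log_nonneg hn1'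
  rw [Real.norm_of_nonneg (by positivity), Real.norm_of_nonneg hlog] at hn
  have hexp : (2 : ℝ) ^ (2 * K * f n) ≤ √(n : ℝ) := by
    calc (2 : ℝ) ^ (2 * K * f n) ≤ Real.exp 1 ^ (2 * K * f n) := by
          gcongr
          linarith [Real.add_one_le_exp (1 : ℝ)]
      _ = Real.exp (2 * K * f n) := by rw [← Real.exp_nat_mul]; push_cast; ring_nf
      _ ≤ Real.exp (Real.log n / 2) := by
          gcongr
          calc 2 * (K : ℝ) * f n ≤ 2 * K * (1 / (4 * K + 4) * Real.log n) := by gcongr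
            _ = (K / (K + 1)) * (Real.log n / 2) := by field_simp; ring
            _ ≤ 1 * (Real.log n / 2) := by
                gcongr
                rw [div_le_one (by positivity)]
                linarith
            _ = Real.log n / 2 := one_mul _
      _ = √(n : ℝ) := by rw [Real.exp_half, Real.exp_log (by positivity)]
  have hs1 : (1 : ℝ) ≤ √(n : ℝ) := Real.one_le_sqrt.2 hn1'
  have : (A : ℝ) * 2 ^ (K * (2 * f n + 1)) + 1 < n := by
    calc (A : ℝ) * 2 ^ (K * (2 * f n + 1)) + 1 = A * 2 ^ K * 2 ^ (2 * K * f n) + 1 := by ring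
      _ ≤ A * 2 ^ K * √(n : ℝ) + √(n : ℝ) := by gcongr
      _ = (A * 2 ^ K + 1) * √(n : ℝ) := by ring
      _ < √(n : ℝ) * √(n : ℝ) := by gcongr
      _ = n := Real.mul_self_sqrt (by positivity)
  exact_mod_cast this

theorem mainTheorem8 {Q Γ : Type*} [Finite Q] [Finite Γ] {k : ℕ}
    (M : AlternatingTM Bool Q Γ k) (hone : M.IsOneWay) (hreal : M.IsRealtime)
    (f : ℕ → ℕ) (hspace : M.UsesSpace f)
    (hf : (fun n : ℕ => (f n : ℝ)) =o[Filter.atTop] fun n : ℕ => Real.log (n : ℝ)) :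
    M.language ≠ binaryPrimes := by
  intro hM
  obtain ⟨n, hn, hn1⟩ := ((eventually_pow_lt_of_isLittleO_log hf (Nat.card Q)
    ((1 + Nat.card Γ) * k)).and (Filter.eventually_ge_atTop 1)).exists
  obtain ⟨m, rfl⟩ : ∃ m, n = m + 1 := ⟨n - 1, by omega⟩
  obtain ⟨hfin, hcard⟩ := hspace.crossing_bound (m + 1)
  have hle := le_ncard_crossing_of_language_eq hone hM m hfin
  set F := 2 * f (m + 1) + 1
  have hpow : F ^ k * (Nat.card Γ ^ F) ^ k ≤ 2 ^ ((1 + Nat.card Γ) * k * F) := by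
    calc F ^ k * (Nat.card Γ ^ F) ^ k ≤ (2 ^ F) ^ k * ((2 ^ Nat.card Γ) ^ F) ^ k := by
          gcongr <;> exact Nat.lt_two_pow_self.le
      _ = 2 ^ ((1 + Nat.card Γ) * k * F) := by
          rw [← pow_mul, ← pow_mul, ← pow_mul, ← pow_add]
          ring_nf
  have := Nat.mul_le_mul_left (Nat.card Q) hpow
  omega
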